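/- Theorem 3 (exchange relations of Crapo and Schmitt). Let $M$ be a matroid on a set $S$, with rank function $\rho$. Let $\mathrm{Skew}(S)$ be the free skew-symmetric $\mathbb{Z}$-algebra on $S$, that is, the exterior algebra of the free abelian group on $S$; a word on $S$ is identified with the corresponding monomial of $\mathrm{Skew}(S)$. Let $\mathrm{Skew}(S)^{\otimes 2}$ be the tensor square in the category of $\mathbb{Z}_2$-graded algebras. For a word $w$ and $i+j=|w|$, write $$\Delta_{(i,j)}(w)=\sum_{(w)_{i,j}} w_{(1)}\otimes w_{(2)}$$ for the coproduct slice of $w$ of type $(i,j)$: the signed sum over all splittings of $w$ into a subword $w_{(1)}$ of length $i$ and the complementary subword $w_{(2)}$ of length $j$, each taken with the sign of the rearrangement of $w$ into $w_{(1)}w_{(2)}$ (the sign is included in the Sweedler notation). The second Whitney algebra is $W^2(M)=\mathrm{Skew}(S)^{\otimes 2}/I(M)$, where $I(M)$ is the two-sided ideal generated by all slices $\Delta_{(i,j)}(v_1\cdots v_r)$, $i+j=r$, with $\{v_1,\dots,v_r\}$ a dependent set of $M$ consisting of $r$ distinct elements; the image of $a\otimes b$ in $W^2(M)$ is denoted by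 $a\circ b$. Let $u$ and $v$ be words on $S$, of lengths $p$ and $q$, whose sets of letters $A$ and $B$ are independent in $M$, and let $k$ be the nonnegative integer such that $\rho(A\cup B)+k=p+q$. Then in $W^2(M)$ $$\sum_{(v)_{k,\,q-k}} u\,v_{(2)}\circ v_{(1)}\;=\;\sum_{(u)_{p-k,\,k}} u_{(1)}\,v\circ u_{(2)} ,$$ where a slice of type $(i,j)$ with $i<0$ or $j<0$ is zero. -/

import Mathlib

open scoped TensorProduct

noncomputable section

/-- The free skew-symmetric algebra over `ℤ` on the set `S`: the exterior algebra of the free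
abelian group on `S`. Its generators anticommute and have square zero. -/
abbrev Skew (S : Type*) : Type _ := ExteriorAlgebra ℤ (S →₀ ℤ)

namespace Skew

variable {S : Type*}

/-- The generator of `Skew S` given by a letter. -/
def letter (x : S) : Skew S := ExteriorAlgebra.ι ℤ (Finsupp.single x 1)

/-- The monomial `x₁ x₂ ⋯ xₚ` in `Skew S` given by a word. -/
def monomial (w : List S) : Skew S := (w.map letter).prod

/-- The `ℤ/2`-grading of `Skew S` by the parity of the length of monomials. -/
abbrev parity (S : Type*) : ZMod 2 → Submodule ℤ (Skew S) :=
  CliffordAlgebra.evenOdd (0 : QuadraticForm ℤ (S →₀ ℤ))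

/-- The tensor square `Skew S ⊗ Skew S` in the category of `ℤ/2`-graded algebras, with product
`(a₁ ⊗ a₂) (b₁ ⊗ b₂) = (-1) ^ (|a₂| |b₁|) a₁ b₁ ⊗ a₂ b₂`. -/
abbrev TensorSquare (S : Type*) : Type _ := parity S ᵍ⊗[ℤ] parity S

/-- The pure tensor `a ⊗ b`. -/
def tensor (a b : Skew S) : TensorSquare S := a ᵍ⊗ₜ[ℤ] b

/-- The terms `ε · w₍₁₎ ⊗ w₍₂₎` of the coproduct of the word `w`, one for each way of splitting `w`
into a subword `w₍₁₎` and the complementary subword `w₍₂₎`. The sign `ε` is the sign of the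
rearrangement of `w` into `w₍₁₎ w₍₂₎`: moving the first letter to the front of the second part
passes it over all the letters of the first part. -/
def coproductTerms : List S → List (ℤˣ × List S × List S)
  | [] => [(1, [], [])]
  | x :: w =>
      (coproductTerms w).map (fun t => (t.1, x :: t.2.1, t.2.2)) ++
        (coproductTerms w).map (fun t => (t.1 * (-1) ^ t.2.1.length, t.2.1, x :: t.2.2))

/-- The terms `ε · w₍₁₎ ⊗ w₍₂₎` of the coproduct with `w₍₁₎` of length `i` and `w₍₂₎` of
length `j`. -/
def sliceTerms (i j : ℕ) (w : List S) : List (ℤˣ × List S × List S) :=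
  (coproductTerms w).filter (fun t => t.2.1.length = i ∧ t.2.2.length = j)

/-- Sweedler summation over a coproduct slice: the sum of `ε • f w₍₁₎ w₍₂₎` over the terms
`ε · w₍₁₎ ⊗ w₍₂₎` of the slice of type `(i, j)` of the word `w`. -/
def sliceSum {N : Type*} [AddCommGroup N] (i j : ℕ) (w : List S) (f : List S → List S → N) : N :=
  ((sliceTerms i j w).map (fun t => t.1 • f t.2.1 t.2.2)).sum

/-- The coproduct slice `Δ₍ᵢ,ⱼ₎(w) = ∑ w₍₁₎ ⊗ w₍₂₎` in the tensor square. -/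
def slice (i j : ℕ) (w : List S) : TensorSquare S :=
  sliceSum i j w (fun w₁ w₂ => tensor (monomial w₁) (monomial w₂))

end Skew

namespace Matroid

variable {α : Type*}

/-- The set of the letters that occur in a word on the ground set of `M`. -/
def letters (M : Matroid α) (w : List M.E) : Set α := {x | x ∈ w.map Subtype.val}

/-- The two-sided ideal generated by all slices of the monomials `v₁ ⋯ vₚ` of dependent sets
`{v₁, …, vₚ}`. -/
def whitneyIdeal₂ (M : Matroid α) : TwoSidedIdeal (Skew.TensorSquare M.E) :=
  TwoSidedIdeal.span
    {z | ∃ (w : List M.E) (i j : ℕ), w.Nodup ∧ M.Dep (M.letters w) ∧ i + j = w.length ∧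
      z = Skew.slice i j w}

/-- The second Whitney algebra `W²(M)`. -/
abbrev Whitney₂ (M : Matroid α) : Type _ := M.whitneyIdeal₂.ringCon.Quotient

/-- The image `a ∘ b` in `W²(M)` of the tensor `a ⊗ b`. -/
def circ (M : Matroid α) (a b : Skew M.E) : M.Whitney₂ :=
  M.whitneyIdeal₂.ringCon.mk' (Skew.tensor a b)

end Matroid

end

noncomputable section

/-! ### Coproduct terms and products of anticommuting families. -/

namespace Skew

variable {S R N : Type*}

/-! Put `a x = x ∘ 1`, `b x = 1 ∘ x` and `P(w) = ∏ (a x + b x X)` over `W²(M)[X]`, with `X` central.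
The coefficients of `P(w)` are the slices of `w`, so `P(w) = 0` as soon as `w` is longer than the
rank of its letters (`slicePoly_eq_zero_of_eRk_lt`). Both sides of the relation are, up to the same
sign, the coefficient of `X ^ k` in `P(u) a(v)` (`sliceSum_exchange`). Expanding `P(u)` gives the
right side. For the left side, write `a x = -b x X + (a x + b x X)` in each factor of `a(v)` and
expand: the terms are `± P(u v₂) b(v₁) X ^ |v₁|`. Those with `|v₁| < k` vanish because `u v₂` is
longer than `ρ(A ∪ B)`, those with `|v₁| > k` have too high a degree, and those with `|v₁| = k`
contribute the constant term `a(u) a(v₂)` of `P(u v₂)`. -/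

theorem coproductTerms_length_add (w : List S) :
    ∀ t ∈ coproductTerms w, t.2.1.length + t.2.2.length = w.length := by
  induction w with
  | nil => simp [coproductTerms]
  | cons x w ih =>
    intro t ht
    simp only [coproductTerms, List.mem_append, List.mem_map] at ht
    rcases ht with ⟨s, hs, rfl⟩ | ⟨s, hs, rfl⟩ <;>
    · have := ih s hs
      simp only [List.length_cons]
      omega

theorem coproductTerms_snd_sublist (w : List S) :
    ∀ t ∈ coproductTerms w, t.2.2.Sublist w := by
  induction w with
  | nil => simp [coproductTerms]
  | cons x w ih =>
    intro t ht
    simp only [coproductTerms, List.mem_append, List.mem_map] at ht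
    rcases ht with ⟨s, hs, rfl⟩ | ⟨s, hs, rfl⟩
    · exact (ih s hs).cons x
    · exact (ih s hs).cons_cons x

/-- Summing over the whole coproduct lets slices be compared with product expansions term by term.
-/
theorem sliceSum_eq_sum_ite [AddCommGroup N] (i j : ℕ) (w : List S) (f : List S → List S → N) :
    sliceSum i j w f = ((coproductTerms w).map fun t =>
      if t.2.1.length = i ∧ t.2.2.length = j then t.1 • f t.2.1 t.2.2 else 0).sum := by
  unfold sliceSum sliceTerms
  induction coproductTerms w with
  | nil => simp
  | cons t l ih =>
    by_cases h : t.2.1.length = i ∧ t.2.2.length = j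
    · rw [List.filter_cons_of_pos (by simpa using h), List.map_cons, List.sum_cons, ih]
      simp [h]
    · rw [List.filter_cons_of_neg (by simpa using h), ih]
      simp [h]

theorem map_sliceSum {N' : Type*} [AddCommGroup N] [AddCommGroup N'] (φ : N →+ N') (i j : ℕ)
    (w : List S) (f : List S → List S → N) :
    φ (sliceSum i j w f) = sliceSum i j w fun w₁ w₂ => φ (f w₁ w₂) := by
  unfold sliceSum
  rw [map_list_sum, List.map_map]
  congr 1
  refine List.map_congr_left fun t _ => ?_
  simp only [Function.comp, Units.smul_def, map_zsmul]

theorem prod_map_mul_prod_map_of_anticomm [Ring R] {f g : S → R}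
    (h : ∀ x y, g y * f x = -(f x * g y)) (w₁ w₂ : List S) :
    (w₂.map g).prod * (w₁.map f).prod =
      (-1 : ℤˣ) ^ (w₁.length * w₂.length) • ((w₁.map f).prod * (w₂.map g).prod) := by
  have key (y : S) (w : List S) :
      g y * (w.map f).prod = (-1 : ℤˣ) ^ w.length • ((w.map f).prod * g y) := by
    induction w with
    | nil => simp
    | cons x w ih =>
      simp only [List.map_cons, List.prod_cons, List.length_cons]
      rw [← mul_assoc, h, neg_mul, mul_assoc, ih, mul_smul_comm, pow_succ, mul_smul,
        Units.neg_smul, one_smul, smul_neg, mul_assoc]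
  induction w₂ with
  | nil => simp
  | cons y w ih =>
    simp only [List.map_cons, List.prod_cons, List.length_cons]
    rw [mul_assoc, ih, mul_smul_comm, ← mul_assoc, key, smul_mul_assoc, smul_smul, mul_assoc,
      ← pow_add, Nat.mul_succ]

/-- The expansion of a product of sums of anticommuting elements along the coproduct. -/
theorem prod_map_add_of_anticomm [Ring R] {f g : S → R}
    (h : ∀ x y, g y * f x = -(f x * g y)) (w : List S) :
    (w.map fun x => f x + g x).prod = ((coproductTerms w).map fun t =>
      t.1 • ((t.2.1.map f).prod * (t.2.2.map g).prod)).sum := by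
  induction w with
  | nil => simp [coproductTerms]
  | cons x w ih =>
    simp only [List.map_cons, List.prod_cons, coproductTerms, List.map_append, List.map_map,
      List.sum_append]
    rw [add_mul, ih, ← List.sum_map_mul_left, ← List.sum_map_mul_left]
    congr 2
    · refine List.map_congr_left fun t _ => ?_
      simp [mul_smul_comm, mul_assoc]
    · refine List.map_congr_left fun t _ => ?_
      have := prod_map_mul_prod_map_of_anticomm h t.2.1 [x]
      simp only [List.map_cons, List.map_nil, List.prod_cons, List.prod_nil, mul_one,
        List.length_cons, List.length_nil, zero_add] at this
      simp only [Function.comp, List.map_cons, List.prod_cons]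
      rw [mul_smul_comm, ← mul_assoc, this, smul_mul_assoc, smul_smul, mul_assoc]

theorem prod_map_eq_zero_of_not_nodup [Ring R] {c : S → R} (hsq : ∀ x, c x * c x = 0)
    (h : ∀ x y, c y * c x = -(c x * c y)) {w : List S} (hw : ¬ w.Nodup) :
    (w.map c).prod = 0 := by
  have key (x : S) (w : List S) (hx : x ∈ w) : c x * (w.map c).prod = 0 := by
    induction w with
    | nil => simp at hx
    | cons y w ih =>
      rw [List.map_cons, List.prod_cons, ← mul_assoc]
      rcases List.mem_cons.1 hx with rfl | hx
      · rw [hsq, zero_mul]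
      · rw [h, neg_mul, mul_assoc, ih hx, mul_zero, neg_zero]
  induction w with
  | nil => simp at hw
  | cons x w ih =>
    rw [List.map_cons, List.prod_cons]
    by_cases hx : x ∈ w
    · exact key x w hx
    · rw [ih fun hn => hw (List.nodup_cons.2 ⟨hx, hn⟩), mul_zero]

/-! ### The generating polynomial of the slices. -/

open Polynomial

theorem prod_map_C_mul_X [Ring R] (f : S → R) (w : List S) :
    (w.map fun x => C (f x) * X).prod = C (w.map f).prod * X ^ w.length := by
  induction w with
  | nil => simp
  | cons x w ih =>
    simp only [List.map_cons, List.prod_cons, List.length_cons, ih, C_mul]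
    rw [mul_assoc, ← mul_assoc X, X_mul, mul_assoc (C (f x)), pow_succ', mul_assoc]

theorem prod_map_C [Ring R] (f : S → R) (w : List S) :
    (w.map fun x => C (f x)).prod = C (w.map f).prod := by
  rw [map_list_prod, List.map_map]; rfl

theorem prod_map_neg [Ring R] (f : S → R) (w : List S) :
    (w.map fun x => -f x).prod = (-1 : ℤˣ) ^ w.length • (w.map f).prod := by
  induction w with
  | nil => simp
  | cons x w ih =>
    simp [ih, pow_succ, Units.neg_smul, mul_smul_comm]

theorem coeff_units_smul [Ring R] (e : ℤˣ) (p : R[X]) (n : ℕ) : (e • p).coeff n = e • p.coeff n := by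
  rw [Units.smul_def, Units.smul_def, coeff_smul]

theorem coeff_sum_map [Ring R] {ι : Type*} (l : List ι) (f : ι → R[X]) (n : ℕ) :
    (l.map f).sum.coeff n = (l.map fun i => (f i).coeff n).sum := by
  induction l with
  | nil => simp
  | cons i l ih => simp [ih]

/-- The generating polynomial `∏ (a x + b x X)` of a word; its coefficients are the slices. -/
def slicePoly [Ring R] (a b : S → R) (w : List S) : R[X] :=
  (w.map fun x => C (a x) + C (b x) * X).prod

theorem slicePoly_append [Ring R] (a b : S → R) (w w' : List S) :
    slicePoly a b (w ++ w') = slicePoly a b w * slicePoly a b w' := by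
  simp [slicePoly]

theorem coeff_zero_slicePoly [Ring R] (a b : S → R) (w : List S) :
    (slicePoly a b w).coeff 0 = (w.map a).prod := by
  induction w with
  | nil => simp [slicePoly]
  | cons x w ih =>
    rw [slicePoly] at ih
    simp [slicePoly, mul_coeff_zero, ih]

section Anticommuting

variable [Ring R] {a b : S → R}

theorem slicePoly_eq_sum (hab : ∀ x y, b y * a x = -(a x * b y)) (w : List S) :
    slicePoly a b w = ((coproductTerms w).map fun t =>
      t.1 • (C ((t.2.1.map a).prod * (t.2.2.map b).prod) * X ^ t.2.2.length)).sum := by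
  rw [slicePoly, prod_map_add_of_anticomm]
  · simp only [prod_map_C, prod_map_C_mul_X, C_mul, mul_assoc]
  · intro x y
    rw [mul_assoc, X_mul_C, ← mul_assoc, ← C_mul, hab, C_neg, neg_mul, C_mul, mul_assoc]

theorem coeff_slicePoly (hab : ∀ x y, b y * a x = -(a x * b y)) {i j : ℕ} {w : List S}
    (h : i + j = w.length) :
    (slicePoly a b w).coeff j =
      sliceSum i j w fun w₁ w₂ => (w₁.map a).prod * (w₂.map b).prod := by
  rw [slicePoly_eq_sum hab, coeff_sum_map, sliceSum_eq_sum_ite]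
  congr 1
  refine List.map_congr_left fun t ht => ?_
  have := coproductTerms_length_add w t ht
  rw [coeff_units_smul, coeff_C_mul_X_pow]
  by_cases hj : t.2.2.length = j
  · rw [if_pos hj.symm, if_pos ⟨by omega, hj⟩]
  · rw [if_neg (Ne.symm hj), if_neg fun h' => hj h'.2, smul_zero]

theorem coeff_slicePoly_of_length_lt (hab : ∀ x y, b y * a x = -(a x * b y)) {j : ℕ} {w : List S}
    (h : w.length < j) : (slicePoly a b w).coeff j = 0 := by
  rw [slicePoly_eq_sum hab, coeff_sum_map]
  refine List.sum_eq_zero fun r hr => ?_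
  obtain ⟨t, ht, rfl⟩ := List.mem_map.1 hr
  have := coproductTerms_length_add w t ht
  rw [coeff_units_smul, coeff_C_mul_X_pow, if_neg (by omega), smul_zero]

/-- The factors `a x + b x X` again anticommute and square to zero, since the mixed terms `a x b x +
b x a x` cancel. -/
theorem slicePoly_eq_zero_of_not_nodup (haa : ∀ x y, a y * a x = -(a x * a y))
    (hbb : ∀ x y, b y * b x = -(b x * b y)) (hab : ∀ x y, b y * a x = -(a x * b y))
    (ha : ∀ x, a x * a x = 0) (hb : ∀ x, b x * b x = 0) {w : List S} (hw : ¬ w.Nodup) :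
    slicePoly a b w = 0 := by
  have expand (x y : S) : (C (a y) + C (b y) * X) * (C (a x) + C (b x) * X) =
      C (a y * a x) + C (a y * b x + b y * a x) * X + C (b y * b x) * X ^ 2 := by
    simp only [C_mul, C_add, mul_add, add_mul, pow_two]
    simp only [mul_assoc, X_mul_C]
    simp only [← mul_assoc, X_mul_C]
    abel
  refine prod_map_eq_zero_of_not_nodup (fun x => ?_) (fun x y => ?_) hw
  · rw [expand, ha, hb, hab]; simp
  · rw [expand, expand, haa, hbb, hab x y, hab y x]
    simp only [C_neg, C_add]
    noncomm_ring

/-- The exchange relations, in terms of anticommuting families `a`, `b` such that the slices of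
the long words on the letters of `u` and `v` vanish. -/
theorem sliceSum_exchange (hbb : ∀ x y, b y * b x = -(b x * b y))
    (hab : ∀ x y, b y * a x = -(a x * b y)) (u v : List S) (k : ℕ)
    (hz : ∀ w : List S, w.Sublist v → v.length < w.length + k → slicePoly a b (u ++ w) = 0) :
    sliceSum k (v.length - k) v (fun v₁ v₂ =>
        (u.map a).prod * (v₂.map a).prod * (v₁.map b).prod) =
      sliceSum (u.length - k) k u (fun u₁ u₂ =>
        (u₁.map a).prod * (v.map a).prod * (u₂.map b).prod) := by
  -- The sign comes from moving the `k` factors `b` of `u₂` past `a(v)`.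
  have right : (slicePoly a b u * C (v.map a).prod).coeff k = (-1 : ℤˣ) ^ (v.length * k) •
      sliceSum (u.length - k) k u (fun u₁ u₂ =>
        (u₁.map a).prod * (v.map a).prod * (u₂.map b).prod) := by
    rw [coeff_mul_C, slicePoly_eq_sum hab, coeff_sum_map, sliceSum_eq_sum_ite,
      ← List.sum_map_mul_right, List.smul_sum, List.map_map]
    congr 1
    refine List.map_congr_left fun t ht => ?_
    have := coproductTerms_length_add u t ht
    simp only [Function.comp]
    rw [coeff_units_smul, coeff_C_mul_X_pow]
    by_cases hj : t.2.2.length = k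
    · rw [if_pos hj.symm, if_pos ⟨by omega, hj⟩, smul_mul_assoc, mul_assoc,
        prod_map_mul_prod_map_of_anticomm hab, hj, mul_smul_comm, smul_comm, mul_assoc]
    · rw [if_neg (Ne.symm hj), if_neg fun h' => hj h'.2, smul_zero, zero_mul, smul_zero]
  have left : (slicePoly a b u * C (v.map a).prod).coeff k = (-1 : ℤˣ) ^ (v.length * k) •
      sliceSum k (v.length - k) v (fun v₁ v₂ =>
        (u.map a).prod * (v₂.map a).prod * (v₁.map b).prod) := by
    have hc (x y : S) : (C (a y) + C (b y) * X) * (C (-b x) * X) =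
        -(C (-b x) * X * (C (a y) + C (b y) * X)) := by
      simp only [C_neg, neg_mul, mul_neg, add_mul, mul_add]
      simp only [mul_assoc, X_mul_C]
      simp only [← mul_assoc, X_mul_C, ← C_mul, hab y x, hbb x y, C_neg]
      noncomm_ring
    have hv : C (v.map a).prod =
        (v.map fun x => C (-b x) * X + (C (a x) + C (b x) * X)).prod := by
      rw [← prod_map_C]
      congr 2
      ext1 x
      simp
    rw [hv, prod_map_add_of_anticomm hc, ← List.sum_map_mul_left, coeff_sum_map,
      sliceSum_eq_sum_ite, List.smul_sum, List.map_map]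
    congr 1
    refine List.map_congr_left fun t ht => ?_
    have hlen := coproductTerms_length_add v t ht
    have hsub := coproductTerms_snd_sublist v t ht
    have hswap := prod_map_mul_prod_map_of_anticomm hc t.2.1 t.2.2
    have hswap' : (t.2.1.map fun x => C (-b x) * X).prod * slicePoly a b t.2.2 =
        (-1 : ℤˣ) ^ (t.2.1.length * t.2.2.length) •
          (slicePoly a b t.2.2 * (t.2.1.map fun x => C (-b x) * X).prod) := by
      rw [slicePoly, hswap, smul_smul, Int.units_mul_self, one_smul]
    simp only [Function.comp]
    rw [← slicePoly, hswap', prod_map_C_mul_X, prod_map_neg, mul_smul_comm, mul_smul_comm,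
      ← mul_assoc, ← slicePoly_append, ← mul_assoc, coeff_units_smul, coeff_units_smul,
      coeff_mul_X_pow', coeff_mul_C]
    rcases lt_trichotomy t.2.1.length k with h | h | h
    -- Here `|v₂| > |v| - k`, so `P(u v₂) = 0`.
    · rw [hz _ hsub (by omega), if_neg (c := _ ∧ _) fun h' => h.ne h'.1]
      simp
    · rw [if_pos h.le, if_pos ⟨h, by omega⟩, h, Nat.sub_self, coeff_zero_slicePoly,
        List.map_append, List.prod_append, mul_smul_comm, smul_comm t.1, smul_comm t.1, smul_smul]
      congr 1
      -- The swap gives `(-1) ^ (k |v₂|)` and the factors `-b` give `(-1) ^ k`. This matches `(-1) ^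
      -- (k |v|)`, because `|v| = k + |v₂|` and `k * k` has the parity of `k`.
      rw [← hlen, h, ← pow_add, add_mul, pow_add, pow_add, mul_comm t.2.2.length,
        mul_comm ((-1 : ℤˣ) ^ (k * k))]
      congr 1
      rcases Nat.even_or_odd k with hk | hk
      · rw [hk.neg_one_pow, (hk.mul_right k).neg_one_pow]
      · rw [hk.neg_one_pow, (hk.mul hk).neg_one_pow]
    · rw [if_neg (by omega), if_neg (c := _ ∧ _) fun h' => h.ne' h'.1]
      simp
  exact smul_left_cancel _ (left.symm.trans right)

end Anticommuting

/-! ### Letters in the graded tensor square. -/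

theorem monomial_append (w w' : List S) :
    monomial (w ++ w') = monomial w * monomial w' := by
  simp [monomial]

theorem letter_mul_self (x : S) : letter x * letter x = 0 :=
  ExteriorAlgebra.ι_sq_zero _

theorem letter_mul_letter (x y : S) : letter y * letter x = -(letter x * letter y) := by
  have h := ExteriorAlgebra.ι_add_mul_swap (R := ℤ) (Finsupp.single y (1 : ℤ)) (Finsupp.single x 1)
  exact eq_neg_of_add_eq_zero_left h

/-- The embedding `a ↦ a ⊗ 1` of the first tensor factor. -/
def left (S : Type*) : Skew S →+* TensorSquare S :=
  (GradedTensorProduct.includeLeft (parity S) (parity S)).toRingHom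

/-- The embedding `b ↦ 1 ⊗ b` of the second tensor factor. -/
def right (S : Type*) : Skew S →+* TensorSquare S :=
  (GradedTensorProduct.includeRight (parity S) (parity S)).toRingHom

theorem left_mul_right (a b : Skew S) : left S a * right S b = tensor a b :=
  GradedTensorProduct.tmul_one_mul_one_tmul (parity S) (parity S) a b

theorem right_mul_left_letter (x y : S) :
    right S (letter y) * left S (letter x) = -(left S (letter x) * right S (letter y)) := by
  have hm (z : S) : letter z ∈ parity S 1 :=
    CliffordAlgebra.ι_mem_evenOdd_one (0 : QuadraticForm ℤ (S →₀ ℤ)) _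
  have h := GradedTensorProduct.tmul_coe_mul_coe_tmul (R := ℤ) (parity S) (parity S)
    (1 : Skew S) ⟨letter y, hm y⟩ ⟨letter x, hm x⟩ (1 : Skew S)
  rw [left_mul_right]
  refine h.trans ?_
  -- Both letters are odd, so the Koszul sign is `-1`.
  rw [mul_one, uzpow_one]
  simp [tensor, Units.neg_smul]

end Skew

/-! ### Vanishing in the second Whitney algebra. -/

namespace Matroid

open Skew

variable {α : Type*} (M : Matroid α)

/-- The image `x ∘ 1` of a letter. -/
def circLeft (x : M.E) : M.Whitney₂ := M.whitneyIdeal₂.ringCon.mk' (left M.E (letter x))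

/-- The image `1 ∘ x` of a letter. -/
def circRight (x : M.E) : M.Whitney₂ := M.whitneyIdeal₂.ringCon.mk' (right M.E (letter x))

theorem mk_tensor_monomial (w₁ w₂ : List M.E) :
    M.whitneyIdeal₂.ringCon.mk' (tensor (monomial w₁) (monomial w₂)) =
      (w₁.map M.circLeft).prod * (w₂.map M.circRight).prod := by
  simp only [← left_mul_right, monomial, map_mul, map_list_prod, List.map_map]
  rfl

theorem circLeft_mul_circLeft (x y : M.E) :
    M.circLeft y * M.circLeft x = -(M.circLeft x * M.circLeft y) := by
  simp only [circLeft, ← map_mul, ← map_neg, letter_mul_letter x y]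

theorem circRight_mul_circRight (x y : M.E) :
    M.circRight y * M.circRight x = -(M.circRight x * M.circRight y) := by
  simp only [circRight, ← map_mul, ← map_neg, letter_mul_letter x y]

theorem circRight_mul_circLeft (x y : M.E) :
    M.circRight y * M.circLeft x = -(M.circLeft x * M.circRight y) := by
  simp only [circRight, circLeft, ← map_mul, ← map_neg, right_mul_left_letter x y]

/-- The slices of a word that is longer than the rank of its set of letters vanish. -/
theorem slicePoly_eq_zero_of_eRk_lt {w : List M.E} (h : M.eRk (M.letters w) < w.length) :
    slicePoly M.circLeft M.circRight w = 0 := by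
  -- The generators of the ideal only cover words with distinct letters. Repetitions, which occur in
  -- `u v₂` when `u` and `v` share letters, are killed by anticommutation instead.
  by_cases hn : w.Nodup
  · have hfin : (M.letters w).encard = w.length := by
      classical
      have hn' := hn.map Subtype.val_injective
      have : M.letters w = ((w.map Subtype.val).toFinset : Set α) := by
        ext x; simp [letters]
      rw [this, Set.encard_coe_eq_coe_finsetCard, List.toFinset_card_of_nodup hn', List.length_map]
    have hE : M.letters w ⊆ M.E := by
      rintro x hx
      obtain ⟨y, -, rfl⟩ := List.mem_map.1 hx
      exact y.2
    have hdep : M.Dep (M.letters w) := by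
      refine ⟨fun hi => ?_, hE⟩
      rw [hi.eRk_eq_encard, hfin] at h
      exact h.false
    ext j
    rw [Polynomial.coeff_zero]
    by_cases hj : j ≤ w.length
    · rw [coeff_slicePoly M.circRight_mul_circLeft (Nat.sub_add_cancel hj)]
      have hmem : slice (w.length - j) j w ∈ M.whitneyIdeal₂ :=
        TwoSidedIdeal.subset_span ⟨w, _, j, hn, hdep, Nat.sub_add_cancel hj, rfl⟩
      rw [← TwoSidedIdeal.ker_ringCon_mk' M.whitneyIdeal₂, TwoSidedIdeal.mem_ker] at hmem
      rw [← hmem, slice]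
      refine Eq.trans ?_
        (map_sliceSum (M.whitneyIdeal₂.ringCon.mk' : _ →+* M.Whitney₂).toAddMonoidHom _ _ _ _).symm
      congr 1
      ext w₁ w₂
      exact (M.mk_tensor_monomial w₁ w₂).symm
    · exact coeff_slicePoly_of_length_lt M.circRight_mul_circLeft (not_le.1 hj)
  · refine slicePoly_eq_zero_of_not_nodup M.circLeft_mul_circLeft M.circRight_mul_circRight
      M.circRight_mul_circLeft (fun x => ?_) (fun x => ?_) hn
    · simp only [circLeft, ← map_mul, letter_mul_self, map_zero]
    · simp only [circRight, ← map_mul, letter_mul_self, map_zero]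

end Matroid

end

theorem theorem3 {α : Type*} (M : Matroid α) (u v : List M.E) (A B : Set α) (p q k : ℕ)
    (hu : M.letters u = A) (hv : M.letters v = B) (hA : M.Indep A) (hB : M.Indep B)
    (hp : u.length = p) (hq : v.length = q)
    (hk : M.eRk (A ∪ B) + (k : ℕ∞) = (p : ℕ∞) + (q : ℕ∞)) :
    Skew.sliceSum k (q - k) v
        (fun v₁ v₂ => M.circ (Skew.monomial u * Skew.monomial v₂) (Skew.monomial v₁)) =
      Skew.sliceSum (p - k) k u
        (fun u₁ u₂ => M.circ (Skew.monomial u₁ * Skew.monomial v) (Skew.monomial u₂)) := by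
  subst hu hv hp hq
  have key := Skew.sliceSum_exchange M.circRight_mul_circRight M.circRight_mul_circLeft u v k
    (fun w hw hlen => by
      apply M.slicePoly_eq_zero_of_eRk_lt
      have hsub : M.letters (u ++ w) ⊆ M.letters u ∪ M.letters v := by
        intro x hx
        simp only [Matroid.letters, List.map_append, List.mem_append, Set.mem_ofPred_eq,
          Set.mem_union] at hx ⊢
        exact hx.imp_right fun h => (hw.map _).subset h
      refine (M.eRk_mono hsub).trans_lt ?_
      -- Finiteness of the rank allows the length count to be done in `ℕ`.
      have hne : M.eRk (M.letters u ∪ M.letters v) ≠ ⊤ := by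
        intro h
        rw [h, top_add] at hk
        exact absurd hk.symm (by exact_mod_cast ENat.natCast_ne_top (u.length + v.length))
      lift M.eRk (M.letters u ∪ M.letters v) to ℕ using hne with r
      norm_cast at hk ⊢
      rw [List.length_append]
      omega)
  simp only [Matroid.circ, ← Skew.monomial_append, M.mk_tensor_monomial]
  simpa only [List.map_append, List.prod_append] using key
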